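/- Let $\tau$ be a finite first-order vocabulary (finitely many predicate, function and constant symbols). All structures have non-empty universe, and a theory is a (possibly infinite) set of first-order $\tau$-sentences. A class $S$ of $\tau$-structures is \emph{preserved under substructures modulo a finite core} if for every $M \in S$ there is a finite subset $C$ of the universe of $M$ such that every substructure $N \subseteq M$ whose universe contains $C$ belongs to $S$. For $k \in \mathbb{N}$ (including $k = 0$), $S$ is \emph{preserved under substructures modulo $k$-sized cores} if for every $M \in S$ such a set $C$ can be chosen with at most $k$ elements. A theory $T$ is in $PSC_f$ (respectively in $PSC(k)$) if its class of models is preserved under substructures modulo a finite core (respectively modulo $k$-sized cores). A $\Sigma^0_2$ sentence is a prenex sentence whose quantifier prefix begins with $\exists$ and has exactly one alternation of quantifiers, i.e. a sentence $\exists x_1 \cdots \exists x_m \forall y_1 \cdots \forall y_n\, \varphi$ with $\varphi$ quantifier-free and $m, n \ge 1$. \textbf{Theorem.} Let $T$ be a theory over $\tau$ that is in $PSC_f$ or in $PSC(k)$ for some $k \in \mathbb{N}$. Then there is a theory $T'$ over $\tau$, all of whose members are $\Sigma^0_2$ sentences, such that $T$ and $T'$ are equivalent, i.e. have the same models. -/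

import Mathlib

open FirstOrder

universe u v w

namespace SubstructureCores

/-- A class of `L`-structures. As usual in first-order logic, structures have a nonempty
universe. -/
abbrev StructureClass (L : FirstOrder.Language.{u, v}) : Type _ :=
  ∀ (M : Type w) [L.Structure M] [Nonempty M], Prop

/-- `C` is a core of `M` with respect to the class `S`: every substructure of `M` that contains
`C` belongs to `S`. -/
def IsCore {L : FirstOrder.Language.{u, v}} (S : StructureClass.{u, v, w} L)
    (M : Type w) [L.Structure M] (C : Set M) : Prop :=
  ∀ (N : L.Substructure M) [Nonempty N], C ⊆ (N : Set M) → S N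

/-- `S` is preserved under substructures modulo `k`-sized cores. -/
def PreservedModuloCores {L : FirstOrder.Language.{u, v}} (k : ℕ) (S : StructureClass.{u, v, w} L) : Prop :=
  ∀ (M : Type w) [L.Structure M] [Nonempty M], S M →
    ∃ C : Set M, C.encard ≤ k ∧ IsCore S M C

/-- `S` is preserved under substructures modulo a finite core. -/
def PreservedModuloFiniteCore {L : FirstOrder.Language.{u, v}} (S : StructureClass.{u, v, w} L) : Prop :=
  ∀ (M : Type w) [L.Structure M] [Nonempty M], S M →
    ∃ C : Set M, C.Finite ∧ IsCore S M C

/-- The class of models of a theory. -/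
def modelClass {L : FirstOrder.Language.{u, v}} (T : L.Theory) : StructureClass.{u, v, w} L :=
  fun M _ _ => M ⊨ T

/-- The theory `T` is in `PSC(k)`. -/
def InPSC {L : FirstOrder.Language.{u, v}} (k : ℕ) (T : L.Theory) : Prop :=
  PreservedModuloCores k (modelClass.{u, v, w} T)

/-- The theory `T` is in `PSC_f`. -/
def InPSCf {L : FirstOrder.Language.{u, v}} (T : L.Theory) : Prop :=
  PreservedModuloFiniteCore (modelClass.{u, v, w} T)

/-- Two theories are equivalent if they have the same models. -/
def EquivalentTheories {L : FirstOrder.Language.{u, v}} (T T' : L.Theory) : Prop :=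
  ∀ (M : Type w) [L.Structure M] [Nonempty M], M ⊨ T ↔ M ⊨ T'

/-- Prenex formulas whose quantifier prefix is a nonempty block of universal quantifiers. -/
inductive IsPiOne {L : FirstOrder.Language.{u, v}} {α : Type*} : ∀ {n : ℕ}, L.BoundedFormula α n → Prop
  | all_qf {n : ℕ} {φ : L.BoundedFormula α (n + 1)} (h : φ.IsQF) : IsPiOne φ.all
  | all {n : ℕ} {φ : L.BoundedFormula α (n + 1)} (h : IsPiOne φ) : IsPiOne φ.all

/-- Prenex formulas whose quantifier prefix begins with `∃` and has exactly one alternation: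
a nonempty block of existential quantifiers, then a nonempty block of universal ones. Blocks may
contain dummy quantifiers, so on nonempty structures nothing changes if empty blocks are
permitted. -/
inductive IsSigmaTwo {L : FirstOrder.Language.{u, v}} {α : Type*} : ∀ {n : ℕ}, L.BoundedFormula α n → Prop
  | ex_pi {n : ℕ} {φ : L.BoundedFormula α (n + 1)} (h : IsPiOne φ) : IsSigmaTwo φ.ex
  | ex {n : ℕ} {φ : L.BoundedFormula α (n + 1)} (h : IsSigmaTwo φ) : IsSigmaTwo φ.ex

end SubstructureCores

/-!
A core is only a core of one given model, and an elementary extension need not have the same core.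
The proof therefore chooses the core in a model that is already saturated, and keeps that model.

Let `T` be preserved under substructures modulo finite cores, let `T'` be the set of its `Σ₂`
consequences, and let `M ⊨ T'`. Since `Σ₂` sentences are closed under finite disjunctions, the
compactness theorem gives a model `N` of `T` such that every `Σ₂` sentence true in `N` is true in
`M` (`exists_model_sigmaTwo_transfer`).

Pass to the ultrapowers `N*` of `N` and `M*` of `M` over a nonprincipal ultrafilter on `ℕ`. They are
`ℵ₁`-saturated (`ultrapower_saturated`), and `N*` is a model of `T`, so it has a finite core `a`.
A finite part of the `Π₁` type of `a` is realized in `M*`, as this is expressed by a `Σ₂` sentence;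
by saturation some tuple `b` of `M*` realizes all of the type. By the downward Löwenheim–Skolem
theorem, `b` lies in a countable `M₀ ≼ M*`. As `N*` is saturated, `M₀` embeds into `N*` with
`b ↦ a` (`exists_embedding_ultrapower`). The image is a substructure of `N*` that contains the core
`a`, hence a model of `T`. So `M₀`, `M*` and `M` are models of `T` (`model_of_sigmaTwo_transfer`).

To avoid bookkeeping with variables, `Π₁` and `Σ₂` conditions are first described with quantifier
blocks indexed by arbitrary types; `exists_isSigmaTwo` turns such a condition into a prenex
sentence.
-/

namespace SubstructureCores

open FirstOrder.Language Filter

universe u₁ u₂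

variable {L : FirstOrder.Language.{u, v}}

/-! ### Prenex forms over arbitrary families of variables -/

section Prenex

variable {α : Type*} {β : Type u₁} {γ : Type u₂}

theorem isAtomic_restrictFreeVar [DecidableEq α] {n : ℕ} {φ : L.BoundedFormula α n}
    (h : φ.IsAtomic) (f : φ.freeVarFinset → β) : (φ.restrictFreeVar f).IsAtomic := by
  cases h with
  | equal t₁ t₂ => exact .equal _ _
  | rel R ts => exact .rel _ _

theorem isQF_restrictFreeVar [DecidableEq α] {n : ℕ} {φ : L.BoundedFormula α n}
    (h : φ.IsQF) (f : φ.freeVarFinset → β) : (φ.restrictFreeVar f).IsQF := by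
  induction h with
  | falsum => exact .falsum
  | of_isAtomic h => exact (isAtomic_restrictFreeVar h f).isQF
  | imp _ _ ih₁ ih₂ => exact (ih₁ _).imp (ih₂ _)

theorem isPiOne_alls {n : ℕ} {φ : L.BoundedFormula α n} (h : IsPiOne φ) : IsPiOne φ.alls := by
  induction n with
  | zero => exact h
  | succ n ih => exact ih h.all

theorem isPiOne_alls_of_isQF {n : ℕ} (hn : n ≠ 0) {φ : L.BoundedFormula α n} (h : φ.IsQF) :
    IsPiOne φ.alls := by
  obtain ⟨n, rfl⟩ := Nat.exists_eq_succ_of_ne_zero hn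
  exact isPiOne_alls (n := n) (IsPiOne.all_qf h)

theorem isSigmaTwo_exs {n : ℕ} {φ : L.BoundedFormula α n} (h : IsSigmaTwo φ) :
    IsSigmaTwo φ.exs := by
  induction n with
  | zero => exact h
  | succ n ih => exact ih h.ex

theorem isSigmaTwo_exs_of_isPiOne {n : ℕ} (hn : n ≠ 0) {φ : L.BoundedFormula α n}
    (h : IsPiOne φ) : IsSigmaTwo φ.exs := by
  obtain ⟨n, rfl⟩ := Nat.exists_eq_succ_of_ne_zero hn
  exact isSigmaTwo_exs (n := n) (IsSigmaTwo.ex_pi h)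

theorem isPiOne_relabel {m n : ℕ} {φ : L.BoundedFormula α m} (h : IsPiOne φ)
    (f : α → β ⊕ Fin n) : IsPiOne (φ.relabel f) := by
  induction h with
  | all_qf h =>
    rw [BoundedFormula.relabel_all]
    exact .all_qf (h.relabel f)
  | all _ ih =>
    rw [BoundedFormula.relabel_all]
    exact .all ih

/-- The block of quantifiers has to be nonempty, as `IsPiOne` requires at least one quantifier. -/
theorem isPiOne_iAlls [Finite γ] [Nonempty γ] {φ : L.Formula (β ⊕ γ)}
    (h : BoundedFormula.IsQF φ) : IsPiOne (φ.iAlls γ) := by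
  refine isPiOne_alls_of_isQF ?_ (h.relabel _)
  intro h0
  have e := Classical.choice (Classical.choose_spec (Finite.exists_equiv_fin γ))
  simp only [Nat.add_zero] at h0
  rw [h0] at e
  exact (e (Classical.arbitrary γ)).elim0

theorem isSigmaTwo_iExs [Finite γ] [Nonempty γ] {φ : L.Formula (β ⊕ γ)}
    (h : IsPiOne φ) : IsSigmaTwo (φ.iExs γ) := by
  refine isSigmaTwo_exs_of_isPiOne ?_ (isPiOne_relabel h _)
  intro h0
  have e := Classical.choice (Classical.choose_spec (Finite.exists_equiv_fin γ))
  simp only [Nat.add_zero] at h0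
  rw [h0] at e
  exact (e (Classical.arbitrary γ)).elim0

/-- Only finitely many of the variables in `γ` matter to a formula. One dummy variable is added,
so that the finite block of variables is nonempty. -/
theorem exists_finite_variables (φ : L.Formula (β ⊕ γ)) :
    ∃ (G : Type u₂) (_ : Finite G) (_ : Nonempty G) (φ' : L.Formula (β ⊕ G)),
      (BoundedFormula.IsQF φ → BoundedFormula.IsQF φ') ∧
      ∀ (M : Type w) [L.Structure M] [Nonempty M],
        (∀ y' : G → M, ∃ y : γ → M, ∀ x : β → M,
          φ'.Realize (Sum.elim x y') ↔ φ.Realize (Sum.elim x y)) ∧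
        (∀ y : γ → M, ∃ y' : G → M, ∀ x : β → M,
          φ'.Realize (Sum.elim x y') ↔ φ.Realize (Sum.elim x y)) := by
  classical
  let F := BoundedFormula.freeVarFinset φ
  let f : F → β ⊕ Option {c : γ // Sum.inr c ∈ F} := fun a =>
    match a with
    | ⟨Sum.inl b, _⟩ => Sum.inl b
    | ⟨Sum.inr c, h⟩ => Sum.inr (some ⟨c, h⟩)
  have hfin : Finite {c : γ // Sum.inr c ∈ F} :=
    Finite.of_injective (fun c => (⟨Sum.inr c.1, c.2⟩ : F))
      fun c d h => Subtype.ext (Sum.inr_injective (congrArg Subtype.val h))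
  refine ⟨Option {c : γ // Sum.inr c ∈ F}, inferInstance, inferInstance,
    BoundedFormula.restrictFreeVar φ f, fun h => isQF_restrictFreeVar h f, ?_⟩
  intro M _ _
  refine ⟨fun y' => ⟨fun c => if h : Sum.inr c ∈ F then y' (some ⟨c, h⟩) else y' none, ?_⟩,
    fun y => ⟨fun o => o.elim (Classical.arbitrary M) fun c => y c.1, ?_⟩⟩
  · intro x
    refine BoundedFormula.realize_restrictFreeVar _ ?_
    rintro ⟨b | c, h⟩
    · rfl
    · have hc : Sum.inr c ∈ F := h
      change y' (some ⟨c, h⟩) = if h : Sum.inr c ∈ F then y' (some ⟨c, h⟩) else y' none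
      rw [dif_pos hc]
  · intro x
    refine BoundedFormula.realize_restrictFreeVar _ ?_
    rintro ⟨b | c, h⟩ <;> rfl

/-- Universal quantification over an arbitrary family of variables is expressed by a formula. -/
theorem exists_formula_forall (φ : L.Formula (β ⊕ γ)) :
    ∃ ψ : L.Formula β, ∀ (M : Type w) [L.Structure M] [Nonempty M] (x : β → M),
      ψ.Realize x ↔ ∀ y : γ → M, φ.Realize (Sum.elim x y) := by
  obtain ⟨G, _, _, φ', -, h⟩ := exists_finite_variables.{u, v, w} φ
  refine ⟨φ'.iAlls G, fun M _ _ x => ?_⟩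
  rw [Formula.realize_iAlls]
  obtain ⟨h₁, h₂⟩ := h M
  constructor
  · intro H y
    obtain ⟨y', hy⟩ := h₂ y
    exact (hy x).1 (H y')
  · intro H y'
    obtain ⟨y, hy⟩ := h₁ y'
    exact (hy x).2 (H y)

/-- An existential-universal condition on arbitrary families of variables is expressed by a
`Σ₂` sentence. -/
theorem exists_isSigmaTwo (φ : L.Formula (β ⊕ γ)) (hφ : BoundedFormula.IsQF φ) :
    ∃ σ : L.Sentence, IsSigmaTwo σ ∧ ∀ (M : Type w) [L.Structure M] [Nonempty M],
      M ⊨ σ ↔ ∃ x : β → M, ∀ y : γ → M, φ.Realize (Sum.elim x y) := by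
  obtain ⟨G, _, _, φ₁, hφ₁, h⟩ := exists_finite_variables.{u, v, w} φ
  obtain ⟨B, _, _, φ₂, hφ₂, k⟩ := exists_finite_variables.{u, v, w} (φ₁.relabel Sum.swap)
  let φ₃ : L.Formula ((Empty ⊕ B) ⊕ G) := φ₂.relabel (Sum.elim Sum.inr (Sum.inl ∘ Sum.inr))
  have hφ₃ : BoundedFormula.IsQF φ₃ := (hφ₂ ((hφ₁ hφ).relabel _)).relabel _
  refine ⟨(φ₃.iAlls G).iExs B, isSigmaTwo_iExs (isPiOne_iAlls hφ₃), fun M _ _ => ?_⟩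
  obtain ⟨h₁, h₂⟩ := h M
  obtain ⟨k₁, k₂⟩ := k M
  have e₁ : ∀ (x : β → M) (y : G → M), (φ₁.relabel Sum.swap).Realize (Sum.elim y x) ↔
      φ₁.Realize (Sum.elim x y) := fun x y => by
    rw [Formula.realize_relabel]
    exact iff_of_eq (congrArg _ (funext fun a => by cases a <;> rfl))
  have e₂ : ∀ (z : Empty → M) (x : B → M) (y : G → M),
      φ₃.Realize (Sum.elim (Sum.elim z x) y) ↔ φ₂.Realize (Sum.elim y x) := fun z x y => by
    rw [Formula.realize_relabel]
    exact iff_of_eq (congrArg _ (funext fun a => by cases a <;> rfl))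
  rw [Sentence.Realize, Formula.realize_iExs]
  simp only [Formula.realize_iAlls, e₂]
  constructor
  · rintro ⟨x', hx'⟩
    obtain ⟨x, hx⟩ := k₁ x'
    refine ⟨x, fun y => ?_⟩
    obtain ⟨y', hy⟩ := h₂ y
    exact (hy x).1 ((e₁ x y').1 ((hx y').1 (hx' y')))
  · rintro ⟨x, hx⟩
    obtain ⟨x', hx'⟩ := k₂ x
    refine ⟨x', fun y' => ?_⟩
    obtain ⟨y, hy⟩ := h₁ y'
    exact (hx' y').2 ((e₁ x y').2 ((hy x).2 (hx y)))

end Prenex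

/-! ### Semantic `Π₁` and `Σ₂` conditions -/

/-- A condition on tuples `x : β → M` is `Π₁` if it has the form `∀ y, φ(x, y)` with `φ`
quantifier-free. The block `y` of variables may be infinite: only finitely many of them occur
in `φ`. -/
def PiOneDefinable {β : Type w}
    (P : ∀ (M : Type w) [L.Structure M] [Nonempty M], (β → M) → Prop) : Prop :=
  ∃ (γ : Type w) (φ : L.Formula (β ⊕ γ)), BoundedFormula.IsQF φ ∧
    ∀ (M : Type w) [L.Structure M] [Nonempty M] (x : β → M),
      P M x ↔ ∀ y : γ → M, φ.Realize (Sum.elim x y)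

/-- A class of structures is `Σ₂` if it is defined by a condition `∃ x, ∀ y, φ(x, y)` with `φ`
quantifier-free, where the blocks `x` and `y` of variables may be infinite. -/
def SigmaTwoDefinable (S : StructureClass.{u, v, w} L) : Prop :=
  ∃ (β γ : Type w) (φ : L.Formula (β ⊕ γ)), BoundedFormula.IsQF φ ∧
    ∀ (M : Type w) [L.Structure M] [Nonempty M],
      S M ↔ ∃ x : β → M, ∀ y : γ → M, φ.Realize (Sum.elim x y)

theorem PiOneDefinable.exists_sigmaTwo {β : Type w}
    {P : ∀ (M : Type w) [L.Structure M] [Nonempty M], (β → M) → Prop} (h : PiOneDefinable P) :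
    SigmaTwoDefinable (L := L) fun M _ _ => ∃ x : β → M, P M x := by
  obtain ⟨γ, φ, hφ, h⟩ := h
  exact ⟨β, γ, φ, hφ, fun M _ _ => exists_congr fun x => h M x⟩

theorem SigmaTwoDefinable.exists_isSigmaTwo {S : StructureClass.{u, v, w} L}
    (h : SigmaTwoDefinable S) :
    ∃ σ : L.Sentence, IsSigmaTwo σ ∧ ∀ (M : Type w) [L.Structure M] [Nonempty M],
      M ⊨ σ ↔ S M := by
  obtain ⟨β, γ, φ, hφ, h⟩ := h
  obtain ⟨σ, hσ, hM⟩ := SubstructureCores.exists_isSigmaTwo.{u, v, w} φ hφ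
  exact ⟨σ, hσ, fun M _ _ => (hM M).trans (h M).symm⟩

theorem PiOneDefinable.and {β : Type w}
    {P Q : ∀ (M : Type w) [L.Structure M] [Nonempty M], (β → M) → Prop}
    (hP : PiOneDefinable P) (hQ : PiOneDefinable Q) :
    PiOneDefinable (L := L) fun M _ _ (x : β → M) => P M x ∧ Q M x := by
  obtain ⟨γ, φ, hφ, h⟩ := hP
  obtain ⟨δ, ψ, hψ, k⟩ := hQ
  refine ⟨γ ⊕ δ, φ.relabel (Sum.map id Sum.inl) ⊓ ψ.relabel (Sum.map id Sum.inr),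
    (hφ.relabel _).inf (hψ.relabel _), fun M _ _ x => ?_⟩
  refine (and_congr (h M x) (k M x)).trans ?_
  simp only [Formula.realize_inf, Formula.realize_relabel, Sum.elim_comp_map, Function.comp_id]
  constructor
  · exact fun H y => ⟨H.1 _, H.2 _⟩
  · exact fun H => ⟨fun y => (H (Sum.elim y fun _ => Classical.arbitrary M)).1,
      fun y => (H (Sum.elim (fun _ => Classical.arbitrary M) y)).2⟩

theorem PiOneDefinable.forall_mem_finset {β : Type w} (s : Finset (L.Formula β))
    (hs : ∀ ψ ∈ s, PiOneDefinable (L := L) fun (M : Type w) _ _ (x : β → M) => ψ.Realize x) :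
    PiOneDefinable (L := L) fun (M : Type w) _ _ (x : β → M) => ∀ ψ ∈ s, ψ.Realize x := by
  classical
  induction s using Finset.induction_on with
  | empty => exact ⟨PEmpty, ⊤, .top, fun M _ _ x => by simp⟩
  | insert a s _ ih =>
    have h := PiOneDefinable.and (hs a (Finset.mem_insert_self a s))
      (ih fun ψ hψ => hs ψ (Finset.mem_insert_of_mem hψ))
    simpa only [Finset.forall_mem_insert] using h

theorem SigmaTwoDefinable.or {S S' : StructureClass.{u, v, w} L}
    (hS : SigmaTwoDefinable S) (hS' : SigmaTwoDefinable S') :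
    SigmaTwoDefinable (L := L) fun M _ _ => S M ∨ S' M := by
  obtain ⟨β, γ, φ, hφ, h⟩ := hS
  obtain ⟨β', γ', φ', hφ', h'⟩ := hS'
  refine ⟨β ⊕ β', γ ⊕ γ', φ.relabel (Sum.map Sum.inl Sum.inl) ⊔
    φ'.relabel (Sum.map Sum.inr Sum.inr), (hφ.relabel _).sup (hφ'.relabel _), fun M _ _ => ?_⟩
  refine (or_congr (h M) (h' M)).trans ?_
  simp only [Formula.realize_sup, Formula.realize_relabel, Sum.elim_comp_map]
  constructor
  · rintro (⟨x, hx⟩ | ⟨x, hx⟩)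
    · exact ⟨Sum.elim x fun _ => Classical.arbitrary M, fun y => .inl (hx _)⟩
    · exact ⟨Sum.elim (fun _ => Classical.arbitrary M) x, fun y => .inr (hx _)⟩
  · -- The two disjuncts have no universal variable in common, so `∀` distributes over `∨`.
    rintro ⟨x, hx⟩
    by_contra! H
    obtain ⟨⟨y, hy⟩, y', hy'⟩ := And.intro (H.1 (x ∘ Sum.inl)) (H.2 (x ∘ Sum.inr))
    exact (hx (Sum.elim y y')).elim hy hy'

theorem SigmaTwoDefinable.exists_mem_finset (s : Finset L.Sentence)
    (hs : ∀ σ ∈ s, SigmaTwoDefinable (L := L) fun (M : Type w) _ _ => M ⊨ σ) :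
    SigmaTwoDefinable (L := L) fun (M : Type w) _ _ => ∃ σ ∈ s, M ⊨ σ := by
  classical
  induction s using Finset.induction_on with
  | empty => exact ⟨PEmpty, PEmpty, ⊥, .falsum, fun M _ _ => by simp⟩
  | insert a s _ ih =>
    have h := SigmaTwoDefinable.or (hs a (Finset.mem_insert_self a s))
      (ih fun σ hσ => hs σ (Finset.mem_insert_of_mem hσ))
    simpa only [Finset.exists_mem_insert] using h

/-! ### Saturation of ultrapowers -/

/-- The ultrapower of `N` with respect to a nonprincipal ultrafilter on `ℕ`. -/
abbrev Ultrapower (N : Type w) : Type w :=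
  (hyperfilter ℕ : Filter ℕ).Product fun _ : ℕ => N

theorem ultrapower_realize_sentence (N : Type w) [L.Structure N] [Nonempty N] (φ : L.Sentence) :
    Ultrapower N ⊨ φ ↔ N ⊨ φ := by
  rw [Ultraproduct.sentence_realize, eventually_const]

/-- The element of the ultrapower represented by a sequence. -/
noncomputable def toUltrapower {N : Type w} (f : ℕ → N) : Ultrapower N :=
  (f : (hyperfilter ℕ : Filter ℕ).Product fun _ : ℕ => N)

theorem ultrapower_realize_sumElim {N : Type w} [L.Structure N] [Nonempty N] {α β : Type*}
    (φ : L.Formula (α ⊕ β)) (x : α → ℕ → N) (y : β → ℕ → N) :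
    φ.Realize (Sum.elim (fun i => toUltrapower (x i)) fun i => toUltrapower (y i)) ↔
      ∀ᶠ n in (hyperfilter ℕ : Filter ℕ), φ.Realize (Sum.elim (fun i => x i n) fun i => y i n) := by
  have e : (Sum.elim (fun i => toUltrapower (x i)) fun i => toUltrapower (y i)) =
      fun i => toUltrapower (Sum.elim x y i) := funext fun i => by cases i <;> rfl
  have e' : ∀ n, (Sum.elim (fun i => x i n) fun i => y i n) = fun i => Sum.elim x y i n :=
    fun n => funext fun i => by cases i <;> rfl
  simp only [e, e']
  exact Ultraproduct.realize_formula_cast (u := hyperfilter ℕ) φ (Sum.elim x y)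

theorem exists_toUltrapower_eq {N : Type w} {α : Type*} (x : α → Ultrapower N) :
    ∃ x' : α → ℕ → N, (fun i => toUltrapower (x' i)) = x :=
  ⟨fun i => Quotient.out (s := Filter.productSetoid _ _) (x i),
    funext fun i => Quotient.out_eq (s := Filter.productSetoid _ _) (x i)⟩

/-- Ultrapowers over `ℕ` are `ℵ₁`-saturated: a countable set of formulas over a family of
parameters that is finitely satisfiable is realized. -/
theorem ultrapower_saturated {N : Type w} [L.Structure N] [Nonempty N] {α β : Type*}
    (a : α → Ultrapower N) {Φ : Set (L.Formula (α ⊕ β))} (hΦ : Φ.Countable)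
    (h : ∀ F : Finset (L.Formula (α ⊕ β)), (F : Set _) ⊆ Φ →
      ∃ y : β → Ultrapower N, ∀ φ ∈ F, φ.Realize (Sum.elim a y)) :
    ∃ y : β → Ultrapower N, ∀ φ ∈ Φ, φ.Realize (Sum.elim a y) := by
  classical
  rcases Φ.eq_empty_or_nonempty with rfl | hne
  · exact ⟨fun _ => Classical.arbitrary _, by simp⟩
  obtain ⟨φ, rfl⟩ := hΦ.exists_eq_range hne
  obtain ⟨a', rfl⟩ := exists_toUltrapower_eq a
  -- `A j n`: the first `j + 1` formulas are satisfiable together in the `n`-th factor.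
  let A : ℕ → ℕ → Prop := fun j n =>
    ∃ y : β → N, ∀ k ≤ j, (φ k).Realize (Sum.elim (fun i => a' i n) y)
  have hA : ∀ j, ∀ᶠ n in (hyperfilter ℕ : Filter ℕ), A j n := by
    intro j
    obtain ⟨y, hy⟩ := h ((Finset.range (j + 1)).image φ) (by
      intro ψ hψ
      obtain ⟨k, -, rfl⟩ := Finset.mem_image.1 (Finset.mem_coe.1 hψ)
      exact ⟨k, rfl⟩)
    obtain ⟨y', rfl⟩ := exists_toUltrapower_eq y
    have hk : ∀ k ∈ Finset.range (j + 1), ∀ᶠ n in (hyperfilter ℕ : Filter ℕ),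
        (φ k).Realize (Sum.elim (fun i => a' i n) fun i => y' i n) := by
      intro k hk
      exact (ultrapower_realize_sumElim _ _ _).1 (hy (φ k) (Finset.mem_image_of_mem φ hk))
    filter_upwards [(Finset.range (j + 1)).eventually_all.2 hk] with n hn
    exact ⟨_, fun k hk => hn k (Finset.mem_range.2 (Nat.lt_succ_of_le hk))⟩
  -- In the `n`-th factor, satisfy as long an initial segment of length at most `n + 1` as possible.
  have hy : ∀ n, ∃ y : β → N, ∀ j ≤ n, A j n →
      ∀ k ≤ j, (φ k).Realize (Sum.elim (fun i => a' i n) y) := by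
    intro n
    by_cases H : ∃ j ≤ n, A j n
    · have hspec := Nat.findGreatest_spec (P := fun j => A j n) H.choose_spec.1 H.choose_spec.2
      obtain ⟨y, hy⟩ := hspec
      exact ⟨y, fun j hj hAj k hk => hy k (hk.trans (Nat.le_findGreatest hj hAj))⟩
    · exact ⟨fun _ => Classical.arbitrary N, fun j hj hAj => absurd ⟨j, hj, hAj⟩ H⟩
  choose y hy using hy
  refine ⟨fun i => toUltrapower fun n => y n i, ?_⟩
  rintro _ ⟨k, rfl⟩
  rw [ultrapower_realize_sumElim]
  have hlarge : ∀ᶠ n in (hyperfilter ℕ : Filter ℕ), k ≤ n :=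
    (eventually_ge_atTop k).filter_mono Nat.hyperfilter_le_atTop
  filter_upwards [hA k, hlarge] with n hn hkn
  exact hy n k hkn hn k le_rfl

/-! ### Embedding a countable structure into an ultrapower -/

theorem exists_countable_elementarySubstructure [Countable L.Symbols] (M : Type w)
    [L.Structure M] {s : Set M} (hs : s.Countable) :
    ∃ S : L.ElementarySubstructure M, s ⊆ S ∧ Countable S := by
  by_cases hM : Countable M
  · exact ⟨⊤, fun _ _ => trivial, inferInstance⟩
  obtain ⟨S, hS, hc⟩ := exists_elementarySubstructure_card_eq L s Cardinal.aleph0.{w} le_rfl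
    (Cardinal.lift_le.2 hs.le_aleph0)
    (by
      rw [Cardinal.lift_aleph0, Cardinal.lift_le_aleph0]
      exact Cardinal.mk_le_aleph0)
    (by
      rw [Cardinal.lift_aleph0, Cardinal.aleph0_le_lift]
      exact (not_le.1 fun h => hM (Cardinal.mk_le_aleph0_iff.1 h)).le)
  refine ⟨S, hS, Cardinal.mk_le_aleph0_iff.1 ?_⟩
  rw [Cardinal.lift_inj.1 hc]

/-- A map that preserves all quantifier-free formulas is an embedding. -/
theorem exists_embedding_of_isQF {M N : Type w} [L.Structure M] [L.Structure N] (y : M → N)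
    (hy : ∀ φ : L.Formula M, BoundedFormula.IsQF φ → φ.Realize id → φ.Realize y) :
    ∃ e : M ↪[L] N, ∀ m, e m = y m := by
  refine ⟨⟨⟨y, fun m m' hm => ?_⟩, fun f x => ?_, fun r x => ⟨fun h => ?_, fun h => ?_⟩⟩,
    fun _ => rfl⟩
  · by_contra hne
    have h := hy (Term.equal (Term.var m) (Term.var m')).not
      (BoundedFormula.IsQF.not (BoundedFormula.IsAtomic.equal _ _).isQF)
      (by simpa using hne)
    exact (by simpa using h : y m ≠ y m') hm
  · have h := hy
      (Term.equal (Term.func f fun i => Term.var (x i)) (Term.var (Structure.funMap f x)))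
      (BoundedFormula.IsAtomic.equal _ _).isQF (by simp)
    exact (by simpa using h : Structure.funMap f (fun i => y (x i)) = _).symm
  · by_contra hne
    have h' := hy (r.formula fun i => Term.var (x i)).not
      (BoundedFormula.IsQF.not (BoundedFormula.IsAtomic.rel _ _).isQF)
      (by simpa using hne)
    rw [Formula.realize_not, Formula.realize_rel] at h'
    exact h' h
  · have h' := hy (r.formula fun i => Term.var (x i)) (BoundedFormula.IsAtomic.rel _ _).isQF
      (by simpa using h)
    rwa [Formula.realize_rel] at h'

theorem exists_isQF_conjunction {α : Type*} (F : Finset (L.Formula α))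
    (hF : ∀ φ ∈ F, BoundedFormula.IsQF φ) :
    ∃ θ : L.Formula α, BoundedFormula.IsQF θ ∧ ∀ (M : Type w) [L.Structure M] (v : α → M),
      θ.Realize v ↔ ∀ φ ∈ F, φ.Realize v := by
  classical
  induction F using Finset.induction_on with
  | empty => exact ⟨⊤, .top, fun M _ v => by simp⟩
  | insert φ F _ ih =>
    obtain ⟨θ, hθ, h⟩ := ih fun ψ hψ => hF ψ (Finset.mem_insert_of_mem hψ)
    exact ⟨φ ⊓ θ, (hF φ (Finset.mem_insert_self φ F)).inf hθ, fun M _ v => by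
      rw [Formula.realize_inf, h, Finset.forall_mem_insert]⟩

/-- If the tuple `b` in the countable structure `M` satisfies all `Π₁` formulas satisfied by the
tuple `a` in an ultrapower, then `M` embeds into that ultrapower over `b ↦ a`. The quantifier-free
diagram of `M` is realized there by saturation: were a finite part `θ(b, m)` of it not satisfiable
over `a`, then `∀ y, ¬ θ(a, y)` would be a `Π₁` property of `a` that fails for `b`. -/
theorem exists_embedding_ultrapower [Countable L.Symbols] {C M N : Type w} [Countable C]
    [L.Structure M] [Nonempty M] [Countable M] [L.Structure N] [Nonempty N]
    (a : C → Ultrapower N) (b : C → M)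
    (h : ∀ ψ : L.Formula C,
      PiOneDefinable (L := L) (fun (K : Type w) _ _ (x : C → K) => ψ.Realize x) →
      ψ.Realize a → ψ.Realize b) :
    ∃ e : M ↪[L] Ultrapower N, ∀ c, e (b c) = a c := by
  obtain ⟨y, hy⟩ := ultrapower_saturated (β := M) a
    (Φ := {φ | BoundedFormula.IsQF φ ∧ φ.Realize (Sum.elim b id)}) (Set.to_countable _) (by
      intro F hF
      obtain ⟨θ, hθ, hθF⟩ := exists_isQF_conjunction.{u, v, w} F fun φ hφ => (hF hφ).1
      by_contra H
      obtain ⟨ψ, hψ⟩ := exists_formula_forall.{u, v, w} θ.not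
      have hb := h ψ ⟨M, θ.not, BoundedFormula.IsQF.not hθ, hψ⟩
        ((hψ _ a).2 fun y hy => H ⟨y, (hθF _ _).1 hy⟩)
      exact (hψ M b).1 hb id ((hθF M _).2 fun φ hφ => (hF hφ).2))
  obtain ⟨e, he⟩ := exists_embedding_of_isQF (L := L) y fun φ hφ hid => by
    have := hy (φ.relabel Sum.inr) ⟨hφ.relabel _, by
      rw [Formula.realize_relabel]
      exact hid⟩
    rwa [Formula.realize_relabel] at this
  refine ⟨e, fun c => ?_⟩
  have := hy (Term.equal (Term.var (Sum.inr (b c))) (Term.var (Sum.inl c)))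
    ⟨(BoundedFormula.IsAtomic.equal _ _).isQF, by simp⟩
  rw [he]
  simpa using this

/-! ### Transfer of `Σ₂` sentences -/

/-- If `M` satisfies all `Σ₂` consequences of `T`, then some model of `T` satisfies only such
`Σ₂` sentences as hold in `M`. -/
theorem exists_model_sigmaTwo_transfer {T : L.Theory} (M : Type (max u v w)) [L.Structure M]
    [Nonempty M]
    (hM : ∀ σ : L.Sentence, IsSigmaTwo σ →
      (∀ (K : Type (max u v w)) [L.Structure K] [Nonempty K], K ⊨ T → K ⊨ σ) → M ⊨ σ) :
    ∃ (N : Type (max u v w)) (_ : L.Structure N) (_ : Nonempty N), N ⊨ T ∧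
      ∀ S : StructureClass.{u, v, max u v w} L, SigmaTwoDefinable S → S N → S M := by
  classical
  -- `Δ` consists of the negations of the `Σ₂` sentences that fail in `M`.
  let Θ : Set L.Sentence := {σ | SigmaTwoDefinable (L := L)
    (fun (K : Type (max u v w)) _ _ => K ⊨ σ) ∧ ¬ M ⊨ σ}
  let Δ : L.Theory := Formula.not '' Θ
  have hsat : (T ∪ Δ).IsSatisfiable := by
    rw [Theory.isSatisfiable_iff_isFinitelySatisfiable]
    intro T₀ hT₀
    by_contra hns
    let F : Finset L.Sentence := T₀.preimage Formula.not (fun φ _ ψ _ h => by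
      simpa [Formula.not, BoundedFormula.not] using h) |>.filter (· ∈ Θ)
    obtain ⟨σ, hσ, hσF⟩ := (SigmaTwoDefinable.exists_mem_finset.{u, v, max u v w} F
      fun σ hσ => (Finset.mem_filter.1 hσ).2.1).exists_isSigmaTwo
    obtain ⟨τ, hτ, hMτ⟩ := (hσF M).1 (hM σ hσ fun K _ _ hK => by
      rw [hσF]
      by_contra! H
      have : K ⊨ (T₀ : L.Theory) := by
        refine ⟨fun φ hφ => ?_⟩
        rcases hT₀ hφ with hφT | ⟨τ, hτ, rfl⟩
        · exact hK.realize_of_mem φ hφT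
        · exact (Sentence.realize_not K).2
            (H τ (Finset.mem_filter.2 ⟨Finset.mem_preimage.2 hφ, hτ⟩))
      exact hns (Theory.Model.isSatisfiable K))
    exact (Finset.mem_filter.1 hτ).2.2 hMτ
  obtain ⟨N₀⟩ := hsat
  let N := Theory.ModelType.ulift.{u, v, max u v, w} N₀
  have hN : N ⊨ T ∪ Δ := N.is_model
  refine ⟨N, inferInstance, inferInstance, hN.mono Set.subset_union_left, fun S hS hSN => ?_⟩
  obtain ⟨β, γ, φ, hφ, h⟩ := hS
  obtain ⟨σ, hσ, hσS⟩ := exists_isSigmaTwo.{u, v, max u v w} φ hφ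
  by_contra hSM
  have hσM : σ ∈ Θ := ⟨⟨β, γ, φ, hφ, hσS⟩, fun H => hSM ((h M).2 ((hσS M).1 H))⟩
  have := hN.realize_of_mem σ.not (Or.inr ⟨σ, hσM, rfl⟩)
  exact (Sentence.realize_not N).1 this ((hσS N).2 ((h N).1 hSN))

theorem SigmaTwoDefinable.ultrapower_iff {S : StructureClass.{u, v, w} L}
    (hS : SigmaTwoDefinable S) (N : Type w) [L.Structure N] [Nonempty N] :
    S (Ultrapower N) ↔ S N := by
  obtain ⟨σ, -, h⟩ := hS.exists_isSigmaTwo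
  rw [← h, ← h, ultrapower_realize_sentence]

/-- Suppose that every `Σ₂` sentence true in `N` is true in `M`. If the class of models of `T` is
preserved under substructures modulo finite cores and contains `N`, then it contains `M`. -/
theorem model_of_sigmaTwo_transfer [Countable L.Symbols] {T : L.Theory} {M N : Type w}
    [L.Structure M] [Nonempty M] [L.Structure N] [Nonempty N] (hT : InPSCf.{u, v, w} T)
    (hN : N ⊨ T) (h : ∀ S : StructureClass.{u, v, w} L, SigmaTwoDefinable S → S N → S M) :
    M ⊨ T := by
  have hN' : Ultrapower N ⊨ T :=
    ⟨fun φ hφ => (ultrapower_realize_sentence N φ).2 (hN.realize_of_mem φ hφ)⟩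
  obtain ⟨C, hC, hcore⟩ := hT (Ultrapower N) hN'
  have : Finite C := hC
  let a : C → Ultrapower N := Subtype.val
  -- A tuple `b` in the ultrapower of `M` that satisfies the `Π₁` type of the core.
  let p : Set (L.Formula C) := {ψ |
    PiOneDefinable (L := L) (fun (K : Type w) _ _ (x : C → K) => ψ.Realize x) ∧ ψ.Realize a}
  obtain ⟨b, hb⟩ : ∃ b : C → Ultrapower M, ∀ ψ ∈ p, ψ.Realize b := by
    classical
    obtain ⟨b, hb⟩ := ultrapower_saturated (N := M) (α := Empty) Empty.elim
      (Φ := Formula.relabel Sum.inr '' p) (Set.to_countable _) (by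
        intro F hF
        obtain ⟨F, hFp, rfl⟩ := Finset.subset_set_image_iff.1 hF
        have hS := (PiOneDefinable.forall_mem_finset.{u, v, w} F
          fun ψ hψ => (hFp hψ).1).exists_sigmaTwo
        obtain ⟨x, hx⟩ := (hS.ultrapower_iff M).2
          (h _ hS ((hS.ultrapower_iff N).1 ⟨a, fun ψ hψ => (hFp hψ).2⟩))
        refine ⟨x, fun φ hφ => ?_⟩
        obtain ⟨ψ, hψ, rfl⟩ := Finset.mem_image.1 hφ
        exact Formula.realize_relabel.2 (hx ψ hψ))
    exact ⟨b, fun ψ hψ => by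
      simpa only [Formula.realize_relabel, Sum.elim_comp_inr] using
        hb _ (Set.mem_image_of_mem _ hψ)⟩
  obtain ⟨M₀, hbM₀, _⟩ := exists_countable_elementarySubstructure (L := L) (Ultrapower M)
    (Set.countable_range b)
  let b₀ : C → M₀ := fun c => ⟨b c, hbM₀ ⟨c, rfl⟩⟩
  obtain ⟨e, he⟩ := exists_embedding_ultrapower (L := L) a b₀ fun ψ hψ hψa =>
    (M₀.subtype.map_formula ψ b₀).1 (hb ψ ⟨hψ, hψa⟩)
  -- The image of `M₀` contains the core, hence is a model of `T`.
  have hrange : e.toHom.range ⊨ T := by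
    have : Nonempty e.toHom.range := ⟨e.equivRange (Classical.arbitrary M₀)⟩
    exact hcore e.toHom.range fun c hc => ⟨b₀ ⟨c, hc⟩, he ⟨c, hc⟩⟩
  have hM₀ : M₀ ⊨ T := StrongHomClass.theory_model e.equivRange.symm
  have hM' : Ultrapower M ⊨ T := (M₀.theory_model_iff T).1 hM₀
  exact ⟨fun φ hφ => (ultrapower_realize_sentence M φ).1 (hM'.realize_of_mem φ hφ)⟩

end SubstructureCores

theorem mainTheorem5 (L : FirstOrder.Language.{u, v}) [Finite L.Symbols] (T : L.Theory)
    (hT : SubstructureCores.InPSCf.{u, v, max u v w} T ∨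
      ∃ k : ℕ, SubstructureCores.InPSC.{u, v, max u v w} k T) :
    ∃ T' : L.Theory, (∀ φ ∈ T', SubstructureCores.IsSigmaTwo φ) ∧
      SubstructureCores.EquivalentTheories.{u, v, max u v w} T T' := by
  have hf : SubstructureCores.InPSCf.{u, v, max u v w} T := by
    rcases hT with hT | ⟨k, hT⟩
    · exact hT
    · intro M _ _ hM
      obtain ⟨C, hC, hcore⟩ := hT M hM
      exact ⟨C, Set.finite_of_encard_le_coe hC, hcore⟩
  refine ⟨{σ | SubstructureCores.IsSigmaTwo σ ∧
    ∀ (K : Type (max u v w)) [L.Structure K] [Nonempty K], K ⊨ T → K ⊨ σ}, fun φ hφ => hφ.1, ?_⟩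
  intro M _ _
  refine ⟨fun hM => ⟨fun σ hσ => hσ.2 M hM⟩, fun hM => ?_⟩
  obtain ⟨N, _, _, hN, h⟩ := SubstructureCores.exists_model_sigmaTwo_transfer.{u, v, w} (T := T) M
    fun σ hσ hTσ => hM.realize_of_mem σ ⟨hσ, hTσ⟩
  exact SubstructureCores.model_of_sigmaTwo_transfer hf hN h
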